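/- Let $\mathcal H$ be a complex Hilbert space and let $M$ be a (possibly unbounded) self-adjoint operator in $\mathcal H$. Let $(\mathcal L_n)$ be a sequence of finite-dimensional subspaces with $\mathcal L_n\subset \mathrm{Dom}\,M^2$ (not necessarily nested), and let $P_n$ be the orthogonal projection of $\mathcal H$ onto $\mathcal L_n$; assume that $P_nx\to x$ for every $x\in\mathcal H$. The second order spectrum of $M$ relative to $\mathcal L_n$ is $$\mathrm{Spec}_2(M|\mathcal L_n)=\{z\in\mathbb C:\ \det[P_n(M-z)^2|_{\mathcal L_n}]=0\}.$$ Let $\lambda$ be an eigenvalue of $M$ of finite multiplicity which is an isolated point of the spectrum of $M$, and assume (H) for every $\psi\in\mathrm{Dom}\,M$ with $M\psi=\lambda\psi$: $\ \|P_nMP_n\psi-\lambda\psi\|\to0$ and $\|P_nM^2P_n\psi-\lambda^2\psi\|\to0$ as $n\to\infty$. Then $\lambda$ belongs to the uniform limiting set $\Lambda$ of the sets $\mathrm{Spec}_2(M|\mathcal L_n)$, that is, the set of all limits $\lim_{n\to\infty} z_n$ of sequences with $z_n\in\mathrm{Spec}_2(M|\mathcal L_n)$ for all sufficiently large $n$.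 In other words, there are $z_n$ with $z_n\in\mathrm{Spec}_2(M|\mathcal L_n)$ for all large $n$ and $z_n\to\lambda$. -/

import Mathlib

open Filter Topology

namespace SecondOrder

noncomputable section

variable {H : Type*} [NormedAddCommGroup H] [InnerProductSpace ℂ H]

/-- The operator `T - z`, with the same domain as `T`. -/
def shift (T : H →ₗ.[ℂ] H) (z : ℂ) : H →ₗ.[ℂ] H where
  domain := T.domain
  toFun := T.toFun - z • T.domain.subtype

/-- The square `T²` of an unbounded operator, on its natural domain
`{x ∈ Dom T | T x ∈ Dom T}`. -/
def sq (T : H →ₗ.[ℂ] H) : H →ₗ.[ℂ] H where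
  domain :=
    { carrier := {x | ∃ h : x ∈ T.domain, T ⟨x, h⟩ ∈ T.domain}
      zero_mem' := ⟨T.domain.zero_mem, by
        have : T ⟨0, T.domain.zero_mem⟩ = 0 := T.map_zero
        rw [this]; exact T.domain.zero_mem⟩
      add_mem' := by
        rintro x y ⟨hx, hx'⟩ ⟨hy, hy'⟩
        refine ⟨T.domain.add_mem hx hy, ?_⟩
        have : T ⟨x + y, T.domain.add_mem hx hy⟩ = T ⟨x, hx⟩ + T ⟨y, hy⟩ :=
          T.map_add ⟨x, hx⟩ ⟨y, hy⟩
        rw [this]; exact T.domain.add_mem hx' hy'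
      smul_mem' := by
        rintro c x ⟨hx, hx'⟩
        refine ⟨T.domain.smul_mem c hx, ?_⟩
        have : T ⟨c • x, T.domain.smul_mem c hx⟩ = c • T ⟨x, hx⟩ :=
          T.map_smul c ⟨x, hx⟩
        rw [this]; exact T.domain.smul_mem c hx' }
  toFun :=
    { toFun := fun x => T ⟨T ⟨x.1, x.2.1⟩, x.2.2⟩
      map_add' := fun x y => by
        rw [← T.map_add]
        congr 1
        exact Subtype.ext (T.map_add ⟨x.1, x.2.1⟩ ⟨y.1, y.2.1⟩)
      map_smul' := fun c x => by
        rw [RingHom.id_apply, ← T.map_smul]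
        congr 1
        exact Subtype.ext (T.map_smul c ⟨x.1, x.2.1⟩) }

theorem sq_domain_le (T : H →ₗ.[ℂ] H) : (sq T).domain ≤ T.domain :=
  fun _ hx => hx.1

/-- `Dom (T - z)²` contains `Dom T²` (they are in fact equal). -/
theorem sq_domain_le_sq_shift_domain (T : H →ₗ.[ℂ] H) (z : ℂ) :
    (sq T).domain ≤ (sq (shift T z)).domain :=
  fun _ hx => ⟨hx.1, T.domain.sub_mem hx.2 (T.domain.smul_mem z hx.1)⟩

/-- The spectrum of a (possibly unbounded) operator: the complement of the set of those `z` for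
which `T - z : Dom T → H` has a bounded everywhere defined two-sided inverse. -/
def spec (T : H →ₗ.[ℂ] H) : Set ℂ :=
  {z | ∃ R : H →L[ℂ] H,
    (∀ y : H, ∃ h : R y ∈ (shift T z).domain, shift T z ⟨R y, h⟩ = y) ∧
    ∀ x : (shift T z).domain, R (shift T z x) = x}ᶜ

/-- The eigenspace `{ψ ∈ Dom T | T ψ = lam ψ}`. -/
def eigenspace (T : H →ₗ.[ℂ] H) (lam : ℂ) : Submodule ℂ H :=
  (LinearMap.ker (shift T lam).toFun).map (shift T lam).domain.subtype

/-- `lam` is an eigenvalue of `T` of finite multiplicity and an isolated point of the spectrum. -/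
structure IsIsolatedEigenvalueFiniteMult (T : H →ₗ.[ℂ] H) (lam : ℂ) : Prop where
  eigenvalue : eigenspace T lam ≠ ⊥
  finite_mult : FiniteDimensional ℂ (eigenspace T lam)
  isolated : ∀ᶠ w in 𝓝[≠] lam, w ∉ spec T

/-- The truncation `P T|L : L → L`, where `P` is the orthogonal projection onto `L ⊆ Dom T`. -/
def truncation (T : H →ₗ.[ℂ] H) (L : Submodule ℂ H) [L.HasOrthogonalProjection]
    (hL : L ≤ T.domain) : L →ₗ[ℂ] L :=
  L.orthogonalProjectionOnto.toLinearMap ∘ₗ T.toFun ∘ₗ Submodule.inclusion hL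

/-- The second order spectrum of `M` relative to a finite-dimensional `L ⊆ Dom M²`:
the set of `z` with `det (P (M - z)²|L) = 0`. -/
def spec₂ (M : H →ₗ.[ℂ] H) (L : Submodule ℂ H) [FiniteDimensional ℂ L]
    (hL : L ≤ (sq M).domain) : Set ℂ :=
  {z | LinearMap.det
    (truncation (sq (shift M z)) L (hL.trans (sq_domain_le_sq_shift_domain M z))) = 0}

/-- The uniform limiting set of a sequence of subsets of `ℂ`: all limits of sequences whose
`n`-th term lies in the `n`-th set for all large `n`. -/
def uniformLimit (S : ℕ → Set ℂ) : Set ℂ :=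
  {z | ∃ w : ℕ → ℂ, (∀ᶠ n in atTop, w n ∈ S n) ∧ Tendsto w atTop (𝓝 z)}

/-- Condition (H): `P_n M P_n ψ → lam ψ` and `P_n M² P_n ψ → lam² ψ` for every `ψ` with
`M ψ = lam ψ`. -/
def ConditionH (M : H →ₗ.[ℂ] H) (lam : ℂ) (L : ℕ → Submodule ℂ H)
    [∀ n, FiniteDimensional ℂ (L n)] (hL : ∀ n, L n ≤ (sq M).domain) : Prop :=
  ∀ ψ ∈ eigenspace M lam,
    Tendsto (fun n => (truncation M (L n) ((hL n).trans (sq_domain_le M))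
      ((L n).orthogonalProjectionOnto ψ) : H)) atTop (𝓝 (lam • ψ)) ∧
    Tendsto (fun n => (truncation (sq M) (L n) (hL n)
      ((L n).orthogonalProjectionOnto ψ) : H)) atTop (𝓝 (lam ^ 2 • ψ))

end

end SecondOrder

/-! The argument is by contradiction, with a maximum principle for the pencil `A z = P (M - z)²|L`
on a small disc about `lam`. If the disc misses the second order spectrum, `A z` is invertible
there, and a lower bound for `A z` on the circle passes to the centre (`lower_bound_center`). At the
centre none survives: for an eigenvector `ψ`, (H) gives `A lam (P ψ) → 0` while `P ψ → ψ ≠ 0`.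

The bound on the circle, uniform in large `n`, is `norm_pencil_lower_bound`. A vector `v` with a
large component `φ` in the eigenspace is tested against `P φ`, on which the adjoint pencil acts
nearly as `(lam - conj z)²`. For other `v`, the spectral gap at `lam` (`exists_gap`) dominates in
`Re ⟨A z v, v⟩`. Finite multiplicity makes (H) uniform on the eigenspace. -/

namespace SecondOrder

/-! ### Bounded operators, the maximum principle and limiting sets -/

section Abstract

/-- A sequence of linear maps on a finite-dimensional space which tends to zero pointwise tends to
zero uniformly on bounded sets. -/
theorem eventually_forall_norm_le_of_tendsto_zero {E F : Type*} [NormedAddCommGroup E]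
    [InnerProductSpace ℂ E] [FiniteDimensional ℂ E] [NormedAddCommGroup F] [NormedSpace ℂ F]
    (T : ℕ → E →ₗ[ℂ] F) (hT : ∀ x, Tendsto (fun n => T n x) atTop (𝓝 0)) {ε : ℝ} (hε : 0 < ε) :
    ∀ᶠ n in atTop, ∀ x, ‖T n x‖ ≤ ε * ‖x‖ := by
  let b := stdOrthonormalBasis ℂ E
  have h : Tendsto (fun n => ∑ i, ‖T n (b i)‖) atTop (𝓝 0) := by
    simpa using tendsto_finsetSum Finset.univ fun i _ => (hT (b i)).norm
  filter_upwards [h.eventually (gt_mem_nhds hε)] with n hn x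
  calc ‖T n x‖ = ‖∑ i, b.repr x i • T n (b i)‖ := by
        conv_lhs => rw [← b.sum_repr x, map_sum]
        simp
    _ ≤ ∑ i, ‖b.repr x i‖ * ‖T n (b i)‖ := by
        refine (norm_sum_le _ _).trans_eq ?_
        simp [norm_smul]
    _ ≤ ∑ i, ‖x‖ * ‖T n (b i)‖ := by
        refine Finset.sum_le_sum fun i _ => ?_
        gcongr
        rw [b.repr_apply_apply]
        simpa using norm_inner_le_norm (𝕜 := ℂ) (b i) x
    _ = (∑ i, ‖T n (b i)‖) * ‖x‖ := by rw [← Finset.mul_sum, mul_comm]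
    _ ≤ ε * ‖x‖ := by gcongr

theorem differentiable_quadratic {V : Type*} [NormedAddCommGroup V] [NormedSpace ℂ V]
    (B C D : V →L[ℂ] V) : Differentiable ℂ fun z : ℂ => B - (2 * z) • C + z ^ 2 • D := by
  fun_prop

/-- A lower bound for a holomorphic family of invertible operators on a circle persists at the
centre. -/
theorem lower_bound_center {V : Type*} [NormedAddCommGroup V] [NormedSpace ℂ V] [CompleteSpace V]
    {A : ℂ → V →L[ℂ] V} (hA : Differentiable ℂ A) {a : ℂ} {r c : ℝ} (hr : 0 < r) (hc : 0 < c)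
    (hu : ∀ z ∈ Metric.closedBall a r, IsUnit (A z))
    (hb : ∀ z ∈ Metric.sphere a r, ∀ v, c * ‖v‖ ≤ ‖A z v‖) (v : V) :
    c * ‖v‖ ≤ ‖A a v‖ := by
  -- The maximum principle is applied to this function, which equals `v` at the centre.
  let f : ℂ → V := fun z => Ring.inverse (A z) (A a v)
  have hd : DifferentiableOn ℂ f (Metric.closedBall a r) := fun z hz =>
    (((differentiableAt_inverse (hu z hz)).comp z (hA z)).clm_apply
      (differentiableAt_const _)).differentiableWithinAt
  have hf : ∀ z ∈ frontier (Metric.ball a r), ‖f z‖ ≤ ‖A a v‖ / c := by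
    intro z hz
    rw [frontier_ball a hr.ne'] at hz
    rw [le_div_iff₀' hc]
    refine (hb z hz _).trans_eq ?_
    have := Ring.mul_inverse_cancel _ (hu z (Metric.sphere_subset_closedBall hz))
    change ‖(A z * Ring.inverse (A z)) (A a v)‖ = _
    rw [this]; rfl
  have h := Complex.norm_le_of_forall_mem_frontier_norm_le Metric.isBounded_ball
    (hd.diffContOnCl_ball subset_rfl) hf (subset_closure (Metric.mem_ball_self hr))
  have hfa : f a = v := by
    have := Ring.inverse_mul_cancel _ (hu a (Metric.mem_closedBall_self hr.le))
    change (Ring.inverse (A a) * A a) v = v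
    rw [this]; rfl
  rwa [hfa, le_div_iff₀' hc] at h

/-- One sequence must serve every `ε`: `w n` nearly minimises the distance from `a` to `S n`, with
slack `1/(n+1)` because the infimum need not be attained. -/
theorem mem_uniformLimit_of_forall_eventually {S : ℕ → Set ℂ} {a : ℂ}
    (h : ∀ ε > 0, ∀ᶠ n in atTop, ∃ z ∈ S n, dist z a ≤ ε) : a ∈ uniformLimit S := by
  have hex : ∀ n, ∃ w, (S n).Nonempty →
      w ∈ S n ∧ dist a w < Metric.infDist a (S n) + 1 / ((n : ℝ) + 1) := by
    intro n
    by_cases hn : (S n).Nonempty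
    · obtain ⟨w, hw, hw'⟩ := (Metric.infDist_lt_iff hn).1
        (lt_add_of_pos_right (Metric.infDist a (S n)) (Nat.one_div_pos_of_nat (n := n) (α := ℝ)))
      exact ⟨w, fun _ => ⟨hw, hw'⟩⟩
    · exact ⟨0, fun h => absurd h hn⟩
  choose w hw using hex
  refine ⟨w, ?_, ?_⟩
  · filter_upwards [h 1 one_pos] with n ⟨z, hz, _⟩ using (hw n ⟨z, hz⟩).1
  · rw [Metric.tendsto_nhds]
    intro ε hε
    filter_upwards [h (ε / 2) (half_pos hε),
      tendsto_one_div_add_atTop_nhds_zero_nat.eventually (gt_mem_nhds (half_pos hε))]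
      with n ⟨z, hz, hza⟩ hn
    have h1 := (hw n ⟨z, hz⟩).2
    have h2 := Metric.infDist_le_dist_of_mem (x := a) hz
    rw [dist_comm] at hza
    rw [dist_comm]
    linarith

/-- If `0` is isolated in the spectrum of a bounded self-adjoint operator, then the operator is
bounded below on the orthogonal complement of its kernel. -/
theorem exists_norm_le_mul_of_isolated_zero {H : Type*} [NormedAddCommGroup H]
    [InnerProductSpace ℂ H] [CompleteSpace H] {T : H →L[ℂ] H} (hT : IsSelfAdjoint T)
    (h0 : ∀ᶠ w in 𝓝[≠] (0 : ℂ), w ∉ spectrum ℂ T) :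
    ∃ C : ℝ, 0 < C ∧ ∀ v, (∀ u, T u = 0 → inner ℂ u v = 0) → ‖v‖ ≤ C * ‖T v‖ := by
  have hn : IsStarNormal T := hT.isStarNormal
  -- With the convention `0⁻¹ = 0`, inversion is continuous on the spectrum because `0` is not an
  -- accumulation point of it. Thus `G` is a bounded pseudo-inverse of `T`.
  have hcont : ContinuousOn (fun t : ℂ => t⁻¹) (spectrum ℂ T) := by
    intro t ht
    by_cases h : t = 0
    · subst h
      have : 𝓝[spectrum ℂ T] (0 : ℂ) ≤ pure 0 := by
        rw [eventually_nhdsWithin_iff] at h0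
        rw [le_pure_iff, mem_nhdsWithin_iff_eventually]
        filter_upwards [h0] with w hw hw'
        by_contra hne
        exact hw hne hw'
      exact (tendsto_pure_nhds _ _).mono_left this
    · exact (continuousAt_inv₀ h).continuousWithinAt
  set G : H →L[ℂ] H := cfc (fun t : ℂ => t⁻¹) T with hG
  have hid : cfc (fun t : ℂ => t) T = T := cfc_id' ℂ T
  have hcomm : G * T = T * G := by
    have h := cfc_commute_cfc (fun t : ℂ => t⁻¹) (fun t => t) T
    rw [hid] at h
    exact h.eq
  have hTGT : T * (G * T) = T := by
    have h1 : G * T = cfc (fun t : ℂ => t⁻¹ * t) T := by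
      rw [cfc_mul (fun t : ℂ => t⁻¹) (fun t => t) T hcont continuousOn_id, hid]
    have h2 : T * cfc (fun t : ℂ => t⁻¹ * t) T = cfc (fun t : ℂ => t * (t⁻¹ * t)) T := by
      rw [cfc_mul (fun t : ℂ => t) (fun t => t⁻¹ * t) T continuousOn_id
        (hcont.mul continuousOn_id), hid]
    rw [h1, h2]
    conv_rhs => rw [← hid]
    congr 1
    ext t
    by_cases h : t = 0 <;> simp [h]
  refine ⟨‖G‖ + 1, by positivity, fun v hv => ?_⟩
  have hker : T (v - G (T v)) = 0 := by
    rw [map_sub, sub_eq_zero]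
    exact (congrArg (fun S : H →L[ℂ] H => S v) hTGT).symm
  -- This vector lies in the kernel of `T`, hence is orthogonal to `v` by hypothesis and to `G (T v)
  -- = T (G v)` by self-adjointness, so to itself.
  have hz : v - G (T v) = 0 := by
    rw [← inner_self_eq_zero (𝕜 := ℂ)]
    have h1 := hv _ hker
    have h2 : inner ℂ (v - G (T v)) (G (T v)) = 0 := by
      have : G (T v) = T (G v) := congrArg (fun S : H →L[ℂ] H => S v) hcomm
      nth_rewrite 2 [this]
      rw [← ContinuousLinearMap.adjoint_inner_left, hT.adjoint_eq, hker, inner_zero_left]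
    rw [inner_sub_right, h1, h2, sub_zero]
  rw [sub_eq_zero] at hz
  calc ‖v‖ = ‖G (T v)‖ := congrArg _ hz
    _ ≤ ‖G‖ * ‖T v‖ := G.le_opNorm _
    _ ≤ (‖G‖ + 1) * ‖T v‖ := by gcongr; linarith

end Abstract

/-! ### Resolvents of the unbounded operator and the spectral gap -/

section Operators

variable {H : Type*} [NormedAddCommGroup H] [InnerProductSpace ℂ H]

theorem mem_eigenspace_iff {M : H →ₗ.[ℂ] H} {lam : ℂ} {ψ : H} :
    ψ ∈ eigenspace M lam ↔ ∃ h : ψ ∈ M.domain, M ⟨ψ, h⟩ = lam • ψ := by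
  constructor
  · rintro ⟨x, hx, rfl⟩
    exact ⟨x.2, sub_eq_zero.1 hx⟩
  · rintro ⟨h, hψ⟩
    exact ⟨⟨ψ, h⟩, sub_eq_zero.2 hψ, rfl⟩

theorem exists_resolvent {M : H →ₗ.[ℂ] H} {z : ℂ} (hz : z ∉ spec M) :
    ∃ R : H →L[ℂ] H, (∀ y, ∃ h : R y ∈ M.domain, M ⟨R y, h⟩ = y + z • R y) ∧
      ∀ x : M.domain, R (M x) = x + z • R x := by
  rw [spec, Set.mem_compl_iff, not_not] at hz
  obtain ⟨R, h1, h2⟩ := hz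
  refine ⟨R, fun y => ?_, fun x => ?_⟩
  · obtain ⟨h, hy⟩ := h1 y
    exact ⟨h, sub_eq_iff_eq_add.1 hy⟩
  · have hx : R (M x - z • (x : H)) = x := h2 x
    rw [map_sub, map_smul] at hx
    exact sub_eq_iff_eq_add.1 hx

theorem isFormalAdjoint_self [CompleteSpace H] {M : H →ₗ.[ℂ] H} (hM : IsSelfAdjoint M)
    (x y : M.domain) : inner ℂ (M x) (y : H) = inner ℂ (x : H) (M y) := by
  have h := LinearPMap.adjoint_isFormalAdjoint hM.dense_domain
  rw [LinearPMap.isSelfAdjoint_def.1 hM] at h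
  exact h x y

variable {M : H →ₗ.[ℂ] H}

theorem conj_eq_of_eigenspace_ne_bot
    (hs : ∀ x y : M.domain, inner ℂ (M x) (y : H) = inner ℂ (x : H) (M y))
    {lam : ℂ} (h : eigenspace M lam ≠ ⊥) : (starRingEnd ℂ) lam = lam := by
  obtain ⟨ψ, hψ, hne⟩ := Submodule.exists_mem_ne_zero_of_ne_bot h
  obtain ⟨hd, he⟩ := mem_eigenspace_iff.1 hψ
  have := hs ⟨ψ, hd⟩ ⟨ψ, hd⟩
  rw [he, inner_smul_left, inner_smul_right] at this
  exact mul_right_cancel₀ (inner_self_ne_zero.2 hne) this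

/-- The spectral mapping property of the resolvent, in the direction needed here. -/
theorem notMem_spectrum_resolvent {μ z : ℂ} (hz : z ∉ spec M) (hzμ : z ≠ μ) {R : H →L[ℂ] H}
    (hR1 : ∀ y, ∃ h : R y ∈ M.domain, M ⟨R y, h⟩ = y + μ • R y)
    (hR2 : ∀ x : M.domain, R (M x) = x + μ • R x) : (z - μ)⁻¹ ∉ spectrum ℂ R := by
  obtain ⟨S, hS1, hS2⟩ := exists_resolvent hz
  have hne : z - μ ≠ 0 := sub_ne_zero.2 hzμ
  have hRS : ∀ y, (z - μ) • R (S y) = S y - R y := by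
    intro y
    obtain ⟨h, hy⟩ := hS1 y
    have := hR2 ⟨S y, h⟩
    rw [hy, map_add, map_smul] at this
    simp only at this
    rw [sub_smul, sub_eq_sub_iff_add_eq_add, add_comm, this]
  have hSR : ∀ y, (z - μ) • S (R y) = S y - R y := by
    intro y
    obtain ⟨h, hy⟩ := hR1 y
    have := hS2 ⟨R y, h⟩
    rw [hy, map_add, map_smul] at this
    simp only at this
    rw [sub_smul, sub_eq_sub_iff_add_eq_add, add_comm, ← this, add_comm]
  rw [spectrum.notMem_iff]
  -- Formally, the inverse of `1/(z-μ) - 1/(m-μ)` is `(z-μ)(m-μ)/(m-z) = (z-μ)(1 + (z-μ)/(m-z))`.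
  let J : H →L[ℂ] H := (z - μ) • (1 + (z - μ) • S)
  have e1 : (algebraMap ℂ (H →L[ℂ] H) (z - μ)⁻¹ - R) * J = 1 := by
    ext y
    change (algebraMap ℂ (H →L[ℂ] H) (z - μ)⁻¹) ((z - μ) • (y + (z - μ) • S y)) -
      R ((z - μ) • (y + (z - μ) • S y)) = y
    rw [Algebra.algebraMap_eq_smul_one, smul_apply, one_apply_eq_self,
      inv_smul_smul₀ hne, map_smul, map_add, map_smul, hRS, smul_add, smul_sub]
    abel
  have e2 : J * (algebraMap ℂ (H →L[ℂ] H) (z - μ)⁻¹ - R) = 1 := by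
    ext y
    change (z - μ) • (((algebraMap ℂ (H →L[ℂ] H) (z - μ)⁻¹) y - R y) +
      (z - μ) • S ((algebraMap ℂ (H →L[ℂ] H) (z - μ)⁻¹) y - R y)) = y
    rw [Algebra.algebraMap_eq_smul_one, smul_apply, one_apply_eq_self,
      map_sub, map_smul, smul_sub (z - μ), smul_inv_smul₀ hne, hSR, smul_add, smul_sub,
      smul_inv_smul₀ hne]
    module
  exact ⟨⟨_, J, e1, e2⟩, rfl⟩

theorem isSelfAdjoint_resolvent [CompleteSpace H]
    (hs : ∀ x y : M.domain, inner ℂ (M x) (y : H) = inner ℂ (x : H) (M y))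
    {μ : ℂ} (hμ : (starRingEnd ℂ) μ = μ) {R : H →L[ℂ] H}
    (hR : ∀ y, ∃ h : R y ∈ M.domain, M ⟨R y, h⟩ = y + μ • R y) : IsSelfAdjoint R := by
  rw [ContinuousLinearMap.isSelfAdjoint_iff_isSymmetric]
  intro x y
  obtain ⟨h, hx⟩ := hR x
  obtain ⟨h', hy⟩ := hR y
  have := hs ⟨R x, h⟩ ⟨R y, h'⟩
  rw [hx, hy] at this
  simp only [inner_add_left, inner_add_right, inner_smul_left, inner_smul_right, hμ,
    add_left_inj] at this
  exact this.symm

/-- The resolvent at a real point near `lam` reduces the claim to a bounded self-adjoint operator: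
`m ↦ 1/(m-μ)` carries the isolated point `lam` to the isolated point `s`, and `ker (R - s)` lies in
the eigenspace. -/
theorem exists_gap_orthogonal [CompleteSpace H]
    (hs : ∀ x y : M.domain, inner ℂ (M x) (y : H) = inner ℂ (x : H) (M y))
    {lam : ℂ} (hlam : (starRingEnd ℂ) lam = lam) (hiso : ∀ᶠ w in 𝓝[≠] lam, w ∉ spec M) :
    ∃ d : ℝ, 0 < d ∧ ∀ v : M.domain, (v : H) ∈ (eigenspace M lam)ᗮ →
      d * ‖(v : H)‖ ≤ ‖M v - lam • (v : H)‖ := by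
  obtain ⟨δ, hδ, hball⟩ := Metric.mem_nhdsWithin_iff.1 hiso
  set μ : ℂ := lam + ((δ / 2 : ℝ) : ℂ) with hμdef
  have hμlam : μ ≠ lam := by
    simpa [hμdef] using hδ.ne'
  have hμs : μ ∉ spec M := by
    refine hball ⟨?_, hμlam⟩
    rw [Metric.mem_ball, dist_eq_norm, hμdef, add_sub_cancel_left, Complex.norm_real,
      Real.norm_eq_abs, abs_of_pos (by positivity)]
    linarith
  have hμc : (starRingEnd ℂ) μ = μ := by rw [hμdef, map_add, hlam, Complex.conj_ofReal]
  obtain ⟨R, hR1, hR2⟩ := exists_resolvent hμs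
  have hne : lam - μ ≠ 0 := sub_ne_zero.2 hμlam.symm
  set s : ℂ := (lam - μ)⁻¹ with hsdef
  have hs0 : s ≠ 0 := inv_ne_zero hne
  have hsc : IsSelfAdjoint s := by
    change (starRingEnd ℂ) s = s
    rw [hsdef, map_inv₀, map_sub, hlam, hμc]
  let T : H →L[ℂ] H := R - algebraMap ℂ (H →L[ℂ] H) s
  have hT : IsSelfAdjoint T :=
    (isSelfAdjoint_resolvent hs hμc hR1).sub (hsc.algebraMap _)
  have hT0 : ∀ᶠ w in 𝓝[≠] (0 : ℂ), w ∉ spectrum ℂ T := by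
    have hc : ContinuousAt (fun w : ℂ => μ + (s + w)⁻¹) 0 := by
      refine continuousAt_const.add (ContinuousAt.inv₀ (by fun_prop) (by simpa using hs0))
    have hlim : Tendsto (fun w : ℂ => μ + (s + w)⁻¹) (𝓝[≠] 0) (𝓝[≠] lam) := by
      refine tendsto_nhdsWithin_iff.2 ⟨?_, ?_⟩
      · have : μ + (s + 0)⁻¹ = lam := by rw [add_zero, hsdef, inv_inv]; ring
        have h := hc.tendsto
        rw [this] at h
        exact h.mono_left nhdsWithin_le_nhds
      · filter_upwards [self_mem_nhdsWithin] with w hw heq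
        refine hw ?_
        have h1 : (s + w)⁻¹ = s⁻¹ := by
          rw [hsdef, inv_inv, eq_sub_iff_add_eq, add_comm]; exact heq
        simpa using inv_injective h1
    have hsw : ∀ᶠ w in 𝓝[≠] (0 : ℂ), s + w ≠ 0 := by
      have : ContinuousAt (fun w : ℂ => s + w) 0 := by fun_prop
      exact (this.eventually_ne (by simpa using hs0)).filter_mono nhdsWithin_le_nhds
    filter_upwards [hlim.eventually hiso, hsw] with w hw hsw hmem
    have h1 := notMem_spectrum_resolvent hw (by simpa using hsw) hR1 hR2
    rw [add_sub_cancel_left, inv_inv] at h1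
    rw [add_comm] at h1
    apply h1
    rw [← spectrum.sub_singleton_eq] at hmem
    obtain ⟨a, ha, b, hb, hab⟩ := hmem
    rw [Set.mem_singleton_iff] at hb
    rw [← hab, hb]
    simpa using ha
  obtain ⟨C, hC, hb⟩ := exists_norm_le_mul_of_isolated_zero hT hT0
  have hTapp : ∀ v, T v = R v - s • v := fun v => by
    simp [T, Algebra.algebraMap_eq_smul_one]
  set K : ℝ := C * (‖s‖ * (‖R‖ + 1)) with hK
  have hKpos : 0 < K := mul_pos hC (mul_pos (norm_pos_iff.2 hs0) (by positivity))
  refine ⟨K⁻¹, inv_pos.2 hKpos, fun v hv => ?_⟩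
  rw [inv_mul_le_iff₀ hKpos]
  have hvT : ∀ u, T u = 0 → inner ℂ u (v : H) = 0 := by
    intro u hu
    refine (Submodule.mem_orthogonal _ _).1 hv u (mem_eigenspace_iff.2 ?_)
    rw [hTapp, sub_eq_zero] at hu
    obtain ⟨h, hu'⟩ := hR1 u
    have hu2 : u = (lam - μ) • R u := by rw [hu, smul_smul, hsdef, mul_inv_cancel₀ hne, one_smul]
    have hud : u ∈ M.domain := by rw [hu2]; exact M.domain.smul_mem _ h
    refine ⟨hud, ?_⟩
    have : (⟨u, hud⟩ : M.domain) = (lam - μ) • ⟨R u, h⟩ := Subtype.ext hu2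
    rw [this, M.map_smul, hu', hu, smul_add, smul_smul, smul_smul]
    rw [← add_smul]
    congr 1
    have : (lam - μ) * s = 1 := mul_inv_cancel₀ hne
    linear_combination μ * this
  -- From `R (M - μ) = 1` on the domain; this converts the bound for `T` into one for `M - lam`.
  have hTv : T v = (-s) • R (M v - lam • (v : H)) := by
    rw [hTapp, map_sub, map_smul, hR2 v]
    have : s * (lam - μ) = 1 := inv_mul_cancel₀ hne
    have h1 : R (v : H) = (s * (lam - μ)) • R (v : H) := by rw [this, one_smul]
    nth_rewrite 1 [h1]
    module
  calc ‖(v : H)‖ ≤ C * ‖T v‖ := hb v hvT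
    _ ≤ C * (‖s‖ * ((‖R‖ + 1) * ‖M v - lam • (v : H)‖)) := by
      rw [hTv, norm_smul, norm_neg]
      gcongr
      exact (R.le_opNorm _).trans (by gcongr; linarith)
    _ = K * ‖M v - lam • (v : H)‖ := by rw [hK]; ring

/-- On `Dom M` the operator `M - lam` is bounded below modulo the eigenspace. -/
theorem exists_gap [CompleteSpace H]
    (hs : ∀ x y : M.domain, inner ℂ (M x) (y : H) = inner ℂ (x : H) (M y))
    {lam : ℂ} (hlam : (starRingEnd ℂ) lam = lam) (hiso : ∀ᶠ w in 𝓝[≠] lam, w ∉ spec M)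
    [(eigenspace M lam).HasOrthogonalProjection] :
    ∃ d : ℝ, 0 < d ∧ ∀ v : M.domain,
      d * ‖(v : H) - (eigenspace M lam).starProjection v‖ ≤ ‖M v - lam • (v : H)‖ := by
  obtain ⟨d, hd, h⟩ := exists_gap_orthogonal hs hlam hiso
  refine ⟨d, hd, fun v => ?_⟩
  obtain ⟨hq, hq'⟩ := mem_eigenspace_iff.1 ((eigenspace M lam).starProjection_apply_mem (v : H))
  have := h (v - ⟨_, hq⟩) ((eigenspace M lam).sub_starProjection_mem_orthogonal (v : H))
  rw [M.map_sub, hq'] at this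
  refine this.trans_eq ?_
  congr 1
  simp only [AddSubgroupClass.coe_sub]
  module

end Operators

/-! ### The quadratic pencil and its lower bound on a circle -/

noncomputable section Pencil

variable {H : Type*} [NormedAddCommGroup H] [InnerProductSpace ℂ H] {M : H →ₗ.[ℂ] H}

/-- The quadratic pencil `z ↦ P (M - z)²|L`. -/
def pencil (M : H →ₗ.[ℂ] H) (L : Submodule ℂ H) [FiniteDimensional ℂ L]
    (hL : L ≤ (sq M).domain) (z : ℂ) : L →L[ℂ] L :=
  LinearMap.toContinuousLinearMap
    (truncation (sq (shift M z)) L (hL.trans (sq_domain_le_sq_shift_domain M z)))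

variable {L : Submodule ℂ H} [FiniteDimensional ℂ L] (hL : L ≤ (sq M).domain)

theorem pencil_apply (z : ℂ) (v : L) :
    pencil M L hL z v = truncation (sq M) L hL v -
      (2 * z) • truncation M L (hL.trans (sq_domain_le M)) v + z ^ 2 • v := by
  have hv := hL v.2
  have h1 : (sq (shift M z)) ⟨v, sq_domain_le_sq_shift_domain M z hv⟩ =
      (sq M) ⟨v, hv⟩ - (2 * z) • M ⟨v, hv.1⟩ + z ^ 2 • (v : H) := by
    change M (⟨M ⟨v, hv.1⟩, hv.2⟩ - z • ⟨v, hv.1⟩) - z • (M ⟨v, hv.1⟩ - z • (v : H)) =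
      M ⟨M ⟨v, hv.1⟩, hv.2⟩ - (2 * z) • M ⟨v, hv.1⟩ + z ^ 2 • (v : H)
    rw [M.map_sub, M.map_smul]
    module
  change L.orthogonalProjectionOnto ((sq (shift M z)) ⟨v, _⟩) =
    L.orthogonalProjectionOnto ((sq M) ⟨v, hv⟩) -
      (2 * z) • L.orthogonalProjectionOnto (M ⟨v, hv.1⟩) + z ^ 2 • v
  rw [h1, map_add, map_sub, map_smul, map_smul,
    Submodule.orthogonalProjectionOnto_mem_subspace_eq_self]

theorem differentiable_pencil : Differentiable ℂ (pencil M L hL) := by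
  have h : pencil M L hL = fun z =>
      LinearMap.toContinuousLinearMap (truncation (sq M) L hL) -
        (2 * z) • LinearMap.toContinuousLinearMap
          (truncation M L (hL.trans (sq_domain_le M))) + z ^ 2 • (1 : L →L[ℂ] L) := by
    funext z
    ext1 v
    exact pencil_apply hL z v
  rw [h]
  exact differentiable_quadratic _ _ _

theorem isUnit_pencil {z : ℂ} (hz : z ∉ spec₂ M L hL) : IsUnit (pencil M L hL z) := by
  have h : IsUnit (LinearMap.det
      (truncation (sq (shift M z)) L (hL.trans (sq_domain_le_sq_shift_domain M z)))) :=
    isUnit_iff_ne_zero.2 hz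
  exact ((LinearMap.isUnit_iff_isUnit_det _).2 h).map (Module.End.toContinuousLinearMap L)

variable (hs : ∀ x y : M.domain, inner ℂ (M x) (y : H) = inner ℂ (x : H) (M y))

include hs

/-- The projection disappears against `w ∈ L`, and symmetry of `M` moves one factor `M - z` across.
-/
theorem inner_pencil_left (z : ℂ) (v w : L) :
    inner ℂ (pencil M L hL z v) w = inner ℂ (M ⟨v, (hL v.2).1⟩ - z • (v : H))
      (M ⟨w, (hL w.2).1⟩ - (starRingEnd ℂ) z • (w : H)) := by
  have hv := hL v.2
  have hw := hL w.2
  let u : M.domain := ⟨M ⟨v, hv.1⟩, hv.2⟩ - z • ⟨v, hv.1⟩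
  change inner ℂ (L.orthogonalProjectionOnto (M u - z • (u : H))) w = inner ℂ (u : H) _
  rw [Submodule.inner_orthogonalProjectionOnto_eq_of_mem_right, inner_sub_left, inner_smul_left,
    inner_sub_right, inner_smul_right, hs u ⟨w, hw.1⟩]

theorem inner_pencil_comm (z : ℂ) (v w : L) :
    inner ℂ (pencil M L hL z v) w = inner ℂ v (pencil M L hL ((starRingEnd ℂ) z) w) := by
  rw [← inner_conj_symm v, inner_pencil_left hL hs, inner_pencil_left hL hs, inner_conj_symm,
    Complex.conj_conj]

/-- Splitting `z` into real and imaginary parts leaves cross terms that sum to a purely imaginary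
number. -/
theorem re_inner_pencil (z : ℂ) (v : L) :
    (inner ℂ (pencil M L hL z v) v).re =
      ‖M ⟨v, (hL v.2).1⟩ - (z.re : ℂ) • (v : H)‖ ^ 2 - z.im ^ 2 * ‖v‖ ^ 2 := by
  rw [inner_pencil_left hL hs]
  set a : H := M ⟨v, (hL v.2).1⟩ - (z.re : ℂ) • (v : H) with ha
  have h1 : M ⟨v, (hL v.2).1⟩ - z • (v : H) = a - ((z.im : ℂ) * Complex.I) • (v : H) := by
    nth_rewrite 1 [← Complex.re_add_im z]
    rw [ha]; module
  have h2 : M ⟨v, (hL v.2).1⟩ - (starRingEnd ℂ) z • (v : H) =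
      a + ((z.im : ℂ) * Complex.I) • (v : H) := by
    have : (starRingEnd ℂ) z = z.re - z.im * Complex.I := by
      apply Complex.ext <;> simp
    rw [this, ha]; module
  have h3 : (inner ℂ (v : H) a).re = (inner ℂ a (v : H)).re := by
    rw [← inner_conj_symm, Complex.conj_re]
  have h4 : (inner ℂ (v : H) a).im = -(inner ℂ a (v : H)).im := by
    rw [← inner_conj_symm, Complex.conj_im]
  rw [h1, h2, inner_sub_left, inner_add_right, inner_add_right, inner_smul_left, inner_smul_right,
    inner_smul_left, inner_smul_right, inner_self_eq_norm_sq_to_K, inner_self_eq_norm_sq_to_K]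
  simp [h3, h4, ← Complex.ofReal_pow]
  ring

/-- Lower bound for the pencil on a small circle, once the projected eigenspace consists of
approximate eigenvectors. -/
theorem norm_pencil_lower_bound {lam : ℂ} (hlam : (starRingEnd ℂ) lam = lam)
    [(eigenspace M lam).HasOrthogonalProjection] {d r : ℝ} (hr : 0 < r) (hrd : 8 * r ≤ d)
    (hgap : ∀ v : M.domain,
      d * ‖(v : H) - (eigenspace M lam).starProjection v‖ ≤ ‖M v - lam • (v : H)‖)
    (happ : ∀ φ ∈ eigenspace M lam, ∀ z ∈ Metric.sphere lam r,
      ‖(pencil M L hL z (L.orthogonalProjectionOnto φ) : H) - (lam - z) ^ 2 • φ‖ ≤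
        r ^ 2 / 4 * ‖φ‖)
    {z : ℂ} (hz : z ∈ Metric.sphere lam r) (v : L) :
    r ^ 2 / 4 * ‖v‖ ≤ ‖pencil M L hL z v‖ := by
  rw [mem_sphere_iff_norm] at hz
  rcases (norm_nonneg v).eq_or_lt with hv0 | hv0
  · rw [← hv0, mul_zero]; exact norm_nonneg _
  set φ : H := (eigenspace M lam).starProjection (v : H) with hφ
  have hφE : φ ∈ eigenspace M lam := (eigenspace M lam).starProjection_apply_mem _
  by_cases hcase : ‖v‖ / 2 < ‖φ‖
  -- Here `⟨A z v, P φ⟩ = ⟨v, A (conj z) (P φ)⟩` is close to `(lam - conj z)² ‖φ‖²`; the error costs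
  -- `r²/4` out of the `r²/2` supplied by `‖φ‖ > ‖v‖/2`.
  · have hφ0 : 0 < ‖φ‖ := lt_trans (by positivity) hcase
    have hzc : ‖(starRingEnd ℂ) z - lam‖ = r := by
      rw [← hz, ← Complex.norm_conj (z - lam), map_sub, hlam]
    have h1 := happ φ hφE ((starRingEnd ℂ) z) (mem_sphere_iff_norm.2 hzc)
    set y : L := pencil M L hL ((starRingEnd ℂ) z) (L.orthogonalProjectionOnto φ)
    have h2 : ‖inner ℂ (v : H) ((lam - (starRingEnd ℂ) z) ^ 2 • φ)‖ = r ^ 2 * ‖φ‖ ^ 2 := by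
      have : inner ℂ (v : H) φ = inner ℂ φ φ := by
        have h := (eigenspace M lam).starProjection_inner_eq_zero (v : H) φ hφE
        rw [inner_sub_left, sub_eq_zero] at h
        exact h
      rw [inner_smul_right, this, norm_mul, norm_pow, norm_sub_rev, hzc,
        inner_self_eq_norm_sq_to_K]
      simp
    have h3 : ‖inner ℂ v y‖ ≤ ‖pencil M L hL z v‖ * ‖φ‖ := by
      rw [← inner_pencil_comm hL hs]
      refine (norm_inner_le_norm _ _).trans ?_
      gcongr
      exact L.norm_orthogonalProjectionOnto_apply_le φ
    have h4 : ‖inner ℂ (v : H) ((y : H) - (lam - (starRingEnd ℂ) z) ^ 2 • φ)‖ ≤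
        ‖v‖ * (r ^ 2 / 4 * ‖φ‖) :=
      (norm_inner_le_norm _ _).trans (mul_le_mul_of_nonneg_left h1 (norm_nonneg _))
    have h5 : r ^ 2 * ‖φ‖ ^ 2 ≤ ‖pencil M L hL z v‖ * ‖φ‖ + ‖v‖ * (r ^ 2 / 4 * ‖φ‖) := by
      rw [← h2]
      rw [inner_sub_right] at h4
      have h6 := norm_sub_norm_le (inner ℂ (v : H) ((lam - (starRingEnd ℂ) z) ^ 2 • φ))
        (inner ℂ (v : H) (y : H))
      rw [norm_sub_rev] at h6
      have h3' : ‖inner ℂ (v : H) (y : H)‖ ≤ ‖pencil M L hL z v‖ * ‖φ‖ := h3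
      linarith
    have h7 : r ^ 2 * ‖φ‖ ≤ ‖pencil M L hL z v‖ + ‖v‖ * (r ^ 2 / 4) := by
      refine le_of_mul_le_mul_right ?_ hφ0
      linarith
    have h8 : r ^ 2 * (‖v‖ / 2) ≤ r ^ 2 * ‖φ‖ := by gcongr
    linarith
  -- The gap gives `‖(M - lam) v‖ ≥ 4r ‖v‖`, so `‖(M - Re z) v‖ ≥ 3r ‖v‖`, and the real part is at
  -- least `(9 - 1) r² ‖v‖²`.
  · rw [not_lt] at hcase
    set m : H := M ⟨v, (hL v.2).1⟩ with hm
    have hre : lam.im = 0 := Complex.conj_eq_iff_im.1 hlam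
    have h1 := hgap ⟨v, (hL v.2).1⟩
    rw [← hm] at h1
    have h2 : ‖v‖ - ‖φ‖ ≤ ‖(v : H) - φ‖ := norm_sub_norm_le (v : H) φ
    have h3 : ‖lam - z.re‖ ≤ r := by
      have : lam - z.re = ((lam - z).re : ℂ) := by apply Complex.ext <;> simp [hre]
      rw [this, Complex.norm_real, ← hz, norm_sub_rev z]
      exact Complex.abs_re_le_norm _
    have h4 : z.im ^ 2 ≤ r ^ 2 := by
      have : |(z - lam).im| ≤ r := hz ▸ Complex.abs_im_le_norm _
      rw [Complex.sub_im, hre, sub_zero] at this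
      exact sq_le_sq' (abs_le.1 this).1 (abs_le.1 this).2
    have h5 : ‖m - lam • (v : H)‖ ≤ ‖m - (z.re : ℂ) • (v : H)‖ + r * ‖v‖ := by
      have : m - lam • (v : H) = (m - (z.re : ℂ) • (v : H)) - (lam - z.re) • (v : H) := by module
      rw [this]
      refine (norm_sub_le _ _).trans ?_
      rw [norm_smul]
      gcongr
      exact le_rfl
    have h6 : 3 * r * ‖v‖ ≤ ‖m - (z.re : ℂ) • (v : H)‖ := by
      have : d * (‖v‖ / 2) ≤ d * ‖(v : H) - φ‖ := by
        have : 0 ≤ d := by linarith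
        gcongr; linarith
      have h7 : 8 * r * (‖v‖ / 2) ≤ d * (‖v‖ / 2) := by gcongr
      linarith
    have h7 := re_inner_pencil hL hs z v
    rw [← hm] at h7
    have h8 : (inner ℂ (pencil M L hL z v) v).re ≤ ‖pencil M L hL z v‖ * ‖v‖ :=
      (Complex.re_le_norm _).trans (norm_inner_le_norm _ _)
    have h9 : (3 * r * ‖v‖) ^ 2 ≤ ‖m - (z.re : ℂ) • (v : H)‖ ^ 2 := by gcongr
    have h10 : z.im ^ 2 * ‖v‖ ^ 2 ≤ r ^ 2 * ‖v‖ ^ 2 := by gcongr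
    refine le_of_mul_le_mul_right ?_ hv0
    have : 0 ≤ r ^ 2 * ‖v‖ ^ 2 := by positivity
    linarith

end Pencil

end SecondOrder

/-! ### Conclusion -/

theorem theorem1 {H : Type*} [NormedAddCommGroup H] [InnerProductSpace ℂ H] [CompleteSpace H]
    (M : H →ₗ.[ℂ] H) (hM : IsSelfAdjoint M)
    (L : ℕ → Submodule ℂ H) [∀ n, FiniteDimensional ℂ (L n)]
    (hL : ∀ n, L n ≤ (SecondOrder.sq M).domain)
    (hP : ∀ x : H, Tendsto (fun n => ((L n).orthogonalProjectionOnto x : H)) atTop (𝓝 x))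
    (lam : ℂ) (hlam : SecondOrder.IsIsolatedEigenvalueFiniteMult M lam)
    (hH : SecondOrder.ConditionH M lam L hL) :
    lam ∈ SecondOrder.uniformLimit (fun n => SecondOrder.spec₂ M (L n) (hL n)) := by
  open SecondOrder in
  have hs := isFormalAdjoint_self hM
  have hreal := conj_eq_of_eigenspace_ne_bot hs hlam.eigenvalue
  have := hlam.finite_mult
  obtain ⟨d, hd, hgap⟩ := exists_gap hs hreal hlam.isolated
  obtain ⟨ψ, hψ, hψ0⟩ := Submodule.exists_mem_ne_zero_of_ne_bot hlam.eigenvalue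
  let E := eigenspace M lam
  let P : ∀ n, H →ₗ[ℂ] L n := fun n => (L n).orthogonalProjectionOnto.toLinearMap
  let T₁ : ℕ → E →ₗ[ℂ] H := fun n =>
    (L n).subtype ∘ₗ truncation M (L n) ((hL n).trans (sq_domain_le M)) ∘ₗ P n ∘ₗ E.subtype -
      lam • E.subtype
  let T₂ : ℕ → E →ₗ[ℂ] H := fun n =>
    (L n).subtype ∘ₗ truncation (sq M) (L n) (hL n) ∘ₗ P n ∘ₗ E.subtype - lam ^ 2 • E.subtype
  let T₃ : ℕ → E →ₗ[ℂ] H := fun n => (L n).subtype ∘ₗ P n ∘ₗ E.subtype - E.subtype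
  have t₁ : ∀ φ, Tendsto (fun n => T₁ n φ) atTop (𝓝 0) := fun φ =>
    tendsto_sub_nhds_zero_iff.2 (hH φ φ.2).1
  have t₂ : ∀ φ, Tendsto (fun n => T₂ n φ) atTop (𝓝 0) := fun φ =>
    tendsto_sub_nhds_zero_iff.2 (hH φ φ.2).2
  have t₃ : ∀ φ, Tendsto (fun n => T₃ n φ) atTop (𝓝 0) := fun φ =>
    tendsto_sub_nhds_zero_iff.2 (hP φ)
  have hdecomp : ∀ n (φ : E) z,
      (pencil M (L n) (hL n) z ((L n).orthogonalProjectionOnto (φ : H)) : H) -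
        (lam - z) ^ 2 • (φ : H) = T₂ n φ - (2 * z) • T₁ n φ + z ^ 2 • T₃ n φ := by
    intro n φ z
    rw [pencil_apply]
    change _ = (((truncation (sq M) (L n) (hL n) (P n φ) : L n) : H) - lam ^ 2 • (φ : H)) -
      (2 * z) • (((truncation M (L n) ((hL n).trans (sq_domain_le M)) (P n φ) : L n) : H) -
        lam • (φ : H)) + z ^ 2 • (((P n φ : L n) : H) - (φ : H))
    change (((truncation (sq M) (L n) (hL n) (P n φ) : L n) : H) -
      (2 * z) • ((truncation M (L n) ((hL n).trans (sq_domain_le M)) (P n φ) : L n) : H) +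
        z ^ 2 • ((P n φ : L n) : H)) - _ = _
    module
  apply mem_uniformLimit_of_forall_eventually
  intro ε hε
  obtain ⟨r, hr, hrd, hrε⟩ : ∃ r : ℝ, 0 < r ∧ 8 * r ≤ d ∧ r ≤ ε :=
    ⟨min (d / 8) ε, by positivity, by linarith [min_le_left (d / 8) ε], min_le_right _ _⟩
  set K : ℝ := ‖lam‖ + r with hK
  have hK0 : 0 < K := by positivity
  -- Since `‖z‖ ≤ K` on the circle, errors of size `η` in the three terms of `hdecomp` add up to at
  -- most `r²/4`.
  set η : ℝ := r ^ 2 / 4 / (1 + 2 * K + K ^ 2) with hη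
  have hη0 : 0 < η := by positivity
  have hcenter : ∀ᶠ n in atTop,
      ‖pencil M (L n) (hL n) lam ((L n).orthogonalProjectionOnto ψ)‖ <
        r ^ 2 / 4 * ‖(L n).orthogonalProjectionOnto ψ‖ := by
    refine Tendsto.eventually_lt (y := 0) (z := r ^ 2 / 4 * ‖ψ‖) ?_
      ((hP ψ).norm.const_mul _) (mul_pos (by positivity) (norm_pos_iff.2 hψ0))
    have h := (((t₂ ⟨ψ, hψ⟩).sub ((t₁ ⟨ψ, hψ⟩).const_smul (2 * lam))).add
      ((t₃ ⟨ψ, hψ⟩).const_smul (lam ^ 2))).norm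
    simp only [← hdecomp, sub_self, smul_zero, add_zero, norm_zero, ne_eq, OfNat.ofNat_ne_zero,
      not_false_eq_true, zero_pow, zero_smul, sub_zero] at h
    exact h
  filter_upwards [hcenter, eventually_forall_norm_le_of_tendsto_zero T₁ t₁ hη0,
    eventually_forall_norm_le_of_tendsto_zero T₂ t₂ hη0,
    eventually_forall_norm_le_of_tendsto_zero T₃ t₃ hη0] with n hn h₁ h₂ h₃
  by_contra! hno
  refine hn.not_ge (lower_bound_center (differentiable_pencil (hL n)) hr (by positivity)
    (fun z hz => isUnit_pencil (hL n) fun hmem => ?_)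
    (fun z hz v => norm_pencil_lower_bound (hL n) hs hreal hr hrd hgap ?_ hz v) _)
  · exact (hno z hmem).not_ge ((Metric.mem_closedBall.1 hz).trans hrε)
  · intro φ hφ z hz
    have hzK : ‖z‖ ≤ K := by
      rw [mem_sphere_iff_norm] at hz
      rw [hK, ← hz]
      simpa using norm_add_le lam (z - lam)
    have h₁ := h₁ ⟨φ, hφ⟩
    have h₂ := h₂ ⟨φ, hφ⟩
    have h₃ := h₃ ⟨φ, hφ⟩
    rw [hdecomp n ⟨φ, hφ⟩ z]
    calc _ ≤ ‖T₂ n ⟨φ, hφ⟩‖ + ‖(2 * z) • T₁ n ⟨φ, hφ⟩‖ + ‖z ^ 2 • T₃ n ⟨φ, hφ⟩‖ :=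
          (norm_add_le _ _).trans (by gcongr; exact norm_sub_le _ _)
      _ ≤ η * ‖φ‖ + 2 * K * (η * ‖φ‖) + K ^ 2 * (η * ‖φ‖) := by
          rw [norm_smul, norm_smul, norm_mul, norm_pow, Complex.norm_ofNat]
          gcongr
          exacts [h₂, h₁, h₃]
      _ = η * (1 + 2 * K + K ^ 2) * ‖φ‖ := by ring
      _ = r ^ 2 / 4 * ‖φ‖ := by rw [hη, div_mul_cancel₀ _ (by positivity)]
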